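/- All rings are commutative with unit. For a polynomial $f \in R[x]$ let $c(f)$ be the ideal of $R$ generated by the coefficients of $f$; the ring $R$ is called Gaussian if $c(f)\,c(g) = c(fg)$ for all $f, g \in R[x]$. For an $R$-module $M$, let $\operatorname{wgd}_R(M)$ be the least integer $n \ge 0$ for which there is an exact sequence $0 \to F_n \to \cdots \to F_1 \to F_0 \to M \to 0$ with all $F_i$ flat $R$-modules, and $\operatorname{wgd}_R(M) = \infty$ if there is no such $n$; let $\operatorname{wgd}(R) = \sup\{\operatorname{wgd}_R(M) \mid M \text{ an } R\text{-module}\}$ be the weak global dimension of $R$. The nilpotency degree of a nilpotent ideal $I$ is the smallest $k \in \mathbb{N}$ with $I^k = 0$. **Theorem.** Let $R$ be a Gaussian ring admitting a maximal ideal $\mathfrak{m}$ such that the nilradical $\mathcal{N}$ of the localization $R_{\mathfrak{m}}$ is a non-zero nilpotent ideal. If the nilpotency degree of $\mathcal{N}$ is at least $3$, then $\operatorname{wgd}(R) = \infty$. -/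

import Mathlib

universe u

/-- A polynomial `f` is Gaussian if `c(f) c(g) = c(fg)` for every polynomial `g`, where `c` denotes
the content ideal, generated by the coefficients. -/
def IsGaussianPolynomial {R : Type u} [CommRing R] (f : Polynomial R) : Prop :=
  ∀ g : Polynomial R, f.contentIdeal * g.contentIdeal = (f * g).contentIdeal

/-- A commutative ring is Gaussian if every polynomial over it is Gaussian. -/
def IsGaussianRing (R : Type u) [CommRing R] : Prop :=
  ∀ f : Polynomial R, IsGaussianPolynomial f

/-- `M` has a resolution `0 → F n → ⋯ → F 1 → F 0 → M → 0` by flat modules. The resolution is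
indexed by all of `ℕ`, with zero modules in degrees above `n`. -/
def HasFlatResolution (R : Type u) [CommRing R] (M : ModuleCat.{u} R) (n : ℕ) : Prop :=
  ∃ (F : ℕ → ModuleCat.{u} R) (d : ∀ i, F (i + 1) →ₗ[R] F i) (ε : F 0 →ₗ[R] M),
    (∀ i, Module.Flat R (F i)) ∧
    (∀ i, n < i → Subsingleton (F i)) ∧
    Function.Surjective ε ∧
    Function.Exact (d 0) ε ∧
    ∀ i, Function.Exact (d (i + 1)) (d i)

/-- The weak (flat) dimension of a module: the least length of a resolution by flat modules,
and `⊤` if there is no finite resolution by flat modules. -/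
noncomputable def moduleWeakDimension (R : Type u) [CommRing R] (M : ModuleCat.{u} R) : ℕ∞ :=
  ⨅ (n : ℕ) (_ : HasFlatResolution R M n), (n : ℕ∞)

/-- The weak global dimension of a commutative ring: the supremum of the weak dimensions of its
modules. -/
noncomputable def weakGlobalDimension (R : Type u) [CommRing R] : ℕ∞ :=
  ⨆ M : ModuleCat.{u} R, moduleWeakDimension R M

open Polynomial TensorProduct

/-! ### Gaussian rings and products of linear polynomials -/

namespace IsGaussianRing

/-! The local ring `A` of `R` at `m` is again Gaussian, its nilradical `N` is prime, and `S`, the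
localization of `A` at `N`, has nilpotent maximal ideal. Degree at least 3 makes that ideal nonzero:
some `x ∈ N` has `x ^ 2 ≠ 0`, and no element outside `N` kills such an `x`. A nilpotent maximal
ideal puts a copy of the residue field inside `S`, which forces the cokernel of an injection of flat
modules to be flat. Hence a finite flat resolution over `S` resolves only a flat module. As `S` is
flat over `R`, a finite flat resolution of the residue field `κ` of `S` over `R` would make `S ⊗[R]
κ` flat; it is killed by the nonzero maximal ideal, so it would vanish, yet it maps onto `κ`. -/

theorem of_isLocalization {R A : Type*} [CommRing R] [CommRing A] [Algebra R A] (M : Submonoid R)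
    [IsLocalization M A] (hR : IsGaussianRing R) : IsGaussianRing A := by
  have key (f : A[X]) : ∃ f' : R[X], ∃ u : A, IsUnit u ∧ f'.map (algebraMap R A) = C u * f := by
    obtain ⟨b, hb, h⟩ := IsLocalization.integerNormalization_spec M f
    refine ⟨_, _, IsLocalization.map_units A ⟨b, hb⟩, h.trans ?_⟩
    rw [← smul_eq_C_mul, algebraMap_smul]
  have content_unit_mul (u : A) (hu : IsUnit u) (f : A[X]) :
      (C u * f).contentIdeal = f.contentIdeal := by
    refine le_antisymm (contentIdeal_le_contentIdeal_of_dvd (Dvd.intro_left _ rfl))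
      (contentIdeal_le_contentIdeal_of_dvd ?_)
    exact ((hu.map C).dvd_mul_left).mp dvd_rfl
  intro f g
  obtain ⟨f', u, hu, hf⟩ := key f
  obtain ⟨g', v, hv, hg⟩ := key g
  have h := congrArg (Ideal.map (algebraMap R A)) (hR f' g')
  rw [Ideal.map_mul, ← contentIdeal_map_eq_map_contentIdeal, ← contentIdeal_map_eq_map_contentIdeal,
    ← contentIdeal_map_eq_map_contentIdeal, Polynomial.map_mul, hf, hg,
    show C u * f * (C v * g) = C (u * v) * (f * g) by rw [C_mul]; ring,
    content_unit_mul u hu, content_unit_mul v hv, content_unit_mul _ (hu.mul hv)] at h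
  exact h

variable {R : Type*} [CommRing R]

theorem coeff_mul_coeff_mem (hR : IsGaussianRing R) {I : Ideal R} (f g : R[X])
    (h : ∀ n, (f * g).coeff n ∈ I) (i j : ℕ) : f.coeff i * g.coeff j ∈ I := by
  have : f.coeff i * g.coeff j ∈ (f * g).contentIdeal :=
    hR f g ▸ Ideal.mul_mem_mul (coeff_mem_contentIdeal f i) (coeff_mem_contentIdeal g j)
  refine (Ideal.span_le (I := I)).mpr ?_ this
  intro x hx
  obtain ⟨n, -, rfl⟩ := mem_coeffs_iff.mp hx
  exact h n

theorem linear_mul_linear (hR : IsGaussianRing R) {I : Ideal R} {a b c d : R}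
    (h₂ : a * c ∈ I) (h₁ : a * d + b * c ∈ I) (h₀ : b * d ∈ I) :
    a * c ∈ I ∧ a * d ∈ I ∧ b * c ∈ I ∧ b * d ∈ I := by
  have key := coeff_mul_coeff_mem hR (I := I) (C a * X + C b) (C c * X + C d) fun n ↦ by
    have : (C a * X + C b) * (C c * X + C d) =
        C (a * c) * X ^ 2 + C (a * d + b * c) * X + C (b * d) := by
      simp only [C_mul, C_add]; ring
    rw [this]
    simp only [coeff_add, coeff_C_mul, coeff_X_pow, coeff_X, coeff_C]
    refine I.add_mem (I.add_mem ?_ ?_) ?_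
    · split_ifs <;> simp [h₂]
    · split_ifs <;> simp [h₁]
    · split_ifs <;> simp [h₀]
  exact ⟨h₂, by simpa using key 1 0, by simpa using key 0 1, h₀⟩

/-- All coefficients of `(aX + b)(aX - b)` vanish. -/
theorem mul_eq_zero_of_sq_eq_zero (hR : IsGaussianRing R) {a b : R} (ha : a ^ 2 = 0)
    (hb : b ^ 2 = 0) : a * b = 0 := by
  have h := linear_mul_linear hR (I := ⊥) (a := a) (b := b) (c := a) (d := -b)
    (by simp [← sq, ha]) (by simp [mul_comm]) (by simp [← sq, hb])
  simpa [mul_comm] using h.2.2.1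

/-- The product `(aX + b)(bX - ra)` is zero. -/
theorem sq_eq_zero_of_sq_eq_mul_sq (hR : IsGaussianRing R) {a b r : R} (hab : a * b = 0)
    (hr : b ^ 2 = r * a ^ 2) : b ^ 2 = 0 := by
  have h := linear_mul_linear hR (I := ⊥) (a := a) (b := b) (c := b) (d := -(r * a))
    (by simp [hab]) (by simp only [Ideal.mem_bot]; linear_combination hr)
    (by simp only [Ideal.mem_bot]; linear_combination -r * hab)
  simpa [sq] using h.2.2.1

/-- The content of `(aX + b)(bX + a)` is generated by `a ^ 2 + b ^ 2`, so `a ^ 2 = (a ^ 2 + b ^ 2) *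
t`. Since `t` or `1 - t` is a unit, one square is a multiple of the other. -/
theorem sq_eq_zero_or_sq_eq_zero [IsLocalRing R] (hR : IsGaussianRing R) {a b : R}
    (hab : a * b = 0) : a ^ 2 = 0 ∨ b ^ 2 = 0 := by
  have h := linear_mul_linear hR (I := Ideal.span {a ^ 2 + b ^ 2}) (a := a) (b := b) (c := b)
    (d := a) (by simp [hab]) (Ideal.mem_span_singleton.mpr ⟨1, by ring⟩)
    (by simp [mul_comm b a, hab])
  obtain ⟨t, ht⟩ := Ideal.mem_span_singleton.mp h.2.1
  have ht' : a ^ 2 * (1 - t) = t * b ^ 2 := by linear_combination ht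
  rcases IsLocalRing.isUnit_or_isUnit_one_sub_self t with ⟨u, hu⟩ | ⟨u, hu⟩
  · refine Or.inr (sq_eq_zero_of_sq_eq_mul_sq hR hab (r := ↑u⁻¹ * (1 - t)) ?_)
    rw [mul_assoc, mul_comm (1 - t), ht', ← hu, Units.inv_mul_cancel_left]
  · refine Or.inl (sq_eq_zero_of_sq_eq_mul_sq hR (mul_comm a b ▸ hab) (r := ↑u⁻¹ * t) ?_)
    rw [mul_assoc, ← ht', ← hu, mul_comm (a ^ 2), Units.inv_mul_cancel_left]

theorem isPrime_nilradical [IsLocalRing R] (hR : IsGaussianRing R) : (nilradical R).IsPrime := by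
  refine ⟨fun h ↦ ?_, fun {x y} ⟨n, hn⟩ ↦ ?_⟩
  · exact not_isNilpotent_one (R := R) (mem_nilradical.mp (h ▸ Submodule.mem_top))
  · rw [mul_pow, Ideal.zero_eq_bot, Ideal.mem_bot] at hn
    rcases sq_eq_zero_or_sq_eq_zero hR hn with h | h
    · exact Or.inl ⟨n * 2, by rw [pow_mul, h]; exact Ideal.zero_mem _⟩
    · exact Or.inr ⟨n * 2, by rw [pow_mul, h]; exact Ideal.zero_mem _⟩

end IsGaussianRing

/-! ### Flatness over a local ring with nilpotent maximal ideal -/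

section NilpotentMaximalIdeal

open IsLocalRing

variable {S : Type*} [CommRing S] [IsLocalRing S]

theorem IsLocalRing.exists_ne_zero_maximalIdeal_mul_eq_zero (h : IsNilpotent (maximalIdeal S)) :
    ∃ s : S, s ≠ 0 ∧ ∀ a ∈ maximalIdeal S, a * s = 0 := by
  have hne := pow_pred_nilpotencyClass h
  have hpow := pow_nilpotencyClass h
  rw [← Nat.sub_add_cancel (pos_nilpotencyClass_iff.mpr h), pow_succ'] at hpow
  obtain ⟨s, hs, hs0⟩ := Submodule.exists_mem_ne_zero_of_ne_bot hne
  exact ⟨s, hs0, fun a ha ↦ by simpa [hpow] using Ideal.mul_mem_mul ha hs⟩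

variable {K F M : Type*} [AddCommGroup K] [Module S K] [AddCommGroup F] [Module S F]
  [AddCommGroup M] [Module S M]

theorem IsLocalRing.lTensor_quotient_injective [Module.Flat S K] (h : IsNilpotent (maximalIdeal S))
    {f : K →ₗ[S] F} (hf : Function.Injective f) :
    Function.Injective (f.lTensor (S ⧸ maximalIdeal S)) := by
  obtain ⟨s, hs0, hs⟩ := exists_ne_zero_maximalIdeal_mul_eq_zero h
  -- The annihilator of `s` is exactly the maximal ideal, so `1 ↦ s` embeds the residue field in
  -- `S`.
  let ι : (S ⧸ maximalIdeal S) →ₗ[S] S :=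
    (maximalIdeal S).liftQ (LinearMap.toSpanSingleton S S s) fun a ha ↦ by simpa using hs a ha
  have hι : Function.Injective ι := by
    rw [← LinearMap.ker_eq_bot]
    refine Submodule.ker_liftQ_eq_bot _ _ _ fun a ha ↦ ?_
    by_contra hu
    exact hs0 ((IsLocalRing.notMem_maximalIdeal.mp hu).mul_right_eq_zero.mp (by simpa using ha))
  have h₁ : Function.Injective (f.lTensor S ∘ₗ ι.rTensor K) := by
    rw [LinearMap.coe_comp]
    exact (Module.Flat.lTensor_preserves_injective_linearMap f hf).comp
      (Module.Flat.rTensor_preserves_injective_linearMap ι hι)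
  rw [LinearMap.lTensor_comp_rTensor, ← LinearMap.rTensor_comp_lTensor, LinearMap.coe_comp] at h₁
  exact h₁.of_comp

/-- The quotient of `N` is a vector space over the residue field, hence flat over it, so the residue
field case suffices. -/
theorem IsLocalRing.lTensor_quotient_smul_top_injective [Module.Flat S K]
    (h : IsNilpotent (maximalIdeal S)) {f : K →ₗ[S] F} (hf : Function.Injective f)
    (N : Type*) [AddCommGroup N] [Module S N] :
    Function.Injective (f.lTensor (N ⧸ maximalIdeal S • (⊤ : Submodule S N))) := by
  let _ := Ideal.Quotient.field (maximalIdeal S)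
  let k := S ⧸ maximalIdeal S
  let N' := N ⧸ maximalIdeal S • (⊤ : Submodule S N)
  have h₁ : Function.Injective (AlgebraTensorModule.lTensor k k f) :=
    lTensor_quotient_injective h hf
  have h₂ : Function.Injective ((AlgebraTensorModule.lTensor k k f).lTensor N') :=
    Module.Flat.lTensor_preserves_injective_linearMap _ h₁
  have h₃ := AlgebraTensorModule.lTensor_comp_cancelBaseChange S k k (M := N') f
  have h₄ : Function.Injective (AlgebraTensorModule.lTensor k N' f ∘ₗ
      (AlgebraTensorModule.cancelBaseChange S k k N' K).toLinearMap) := by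
    rw [h₃, LinearMap.coe_comp]
    exact (LinearEquiv.injective _).comp h₂
  rw [LinearMap.coe_comp, LinearEquiv.coe_coe, EquivLike.injective_comp] at h₄
  exact h₄

theorem IsLocalRing.lTensor_injective_of_maximalIdeal_pow_smul [Module.Flat S K] [Module.Flat S F]
    (h : IsNilpotent (maximalIdeal S)) {f : K →ₗ[S] F} (hf : Function.Injective f) (n : ℕ)
    (N : Type*) [AddCommGroup N] [Module S N] (hN : maximalIdeal S ^ n • (⊤ : Submodule S N) = ⊥) :
    Function.Injective (f.lTensor N) := by
  induction n generalizing N with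
  | zero =>
    have : Subsingleton N := by
      rw [pow_zero, Ideal.one_eq_top, Submodule.top_smul] at hN
      exact (Submodule.subsingleton_iff S).mp (subsingleton_of_bot_eq_top hN.symm)
    exact Function.injective_of_subsingleton _
  | succ n ih =>
    let P := maximalIdeal S • (⊤ : Submodule S N)
    have hP : maximalIdeal S ^ n • (⊤ : Submodule S P) = ⊥ := by
      apply Submodule.map_injective_of_injective P.subtype_injective
      rw [Submodule.map_smul'', Submodule.map_top, Submodule.range_subtype, Submodule.map_bot,
        ← Submodule.mul_smul, ← pow_succ, hN]
    -- Diagram chase along `0 → P → N → N ⧸ P → 0`, where flatness of `F` keeps `P ⊗ F → N ⊗ F`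
    -- injective.
    rw [injective_iff_map_eq_zero]
    intro z hz
    have hex : Function.Exact P.subtype P.mkQ := LinearMap.exact_subtype_mkQ P
    have h₁ : P.mkQ.rTensor K z = 0 := by
      apply lTensor_quotient_smul_top_injective h hf N
      rw [map_zero, ← LinearMap.comp_apply, LinearMap.lTensor_comp_rTensor,
        ← LinearMap.rTensor_comp_lTensor, LinearMap.comp_apply, hz, map_zero]
    obtain ⟨w, rfl⟩ := (rTensor_exact K hex P.mkQ_surjective z).mp h₁
    have h₂ : w = 0 := by
      apply ih P hP
      apply Module.Flat.rTensor_preserves_injective_linearMap (M := F) _ P.subtype_injective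
      rw [map_zero, map_zero, ← LinearMap.comp_apply, LinearMap.rTensor_comp_lTensor,
        ← LinearMap.lTensor_comp_rTensor, LinearMap.comp_apply, hz]
    rw [h₂, map_zero]

theorem Module.Flat.of_exact_of_isNilpotent_maximalIdeal [Module.Flat S K] [Module.Flat S F]
    (h : IsNilpotent (maximalIdeal S))
    {f : K →ₗ[S] F} {g : F →ₗ[S] M} (hf : Function.Injective f) (hfg : Function.Exact f g)
    (hg : Function.Surjective g) : Module.Flat S M := by
  obtain ⟨n, hn⟩ := id h
  rw [Module.Flat.iff_lTensor_injectiveₛ]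
  intro P _ _ N
  let _ : AddCommGroup P := Module.addCommMonoidToAddCommGroup S
  refine lTensor_injective_of_exact_of_exact_of_rTensor_injective hfg hg
    (LinearMap.exact_subtype_mkQ N) N.mkQ_surjective ?_
    (Module.Flat.lTensor_preserves_injective_linearMap _ N.subtype_injective)
  rw [← LinearMap.lTensor_inj_iff_rTensor_inj]
  exact lTensor_injective_of_maximalIdeal_pow_smul h hf n _ (by simp [hn])

theorem Module.Flat.of_finite_resolution_of_isNilpotent_maximalIdeal
    (h : IsNilpotent (maximalIdeal S)) {F : ℕ → Type*} [∀ i, AddCommGroup (F i)]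
    [∀ i, Module S (F i)] [∀ i, Module.Flat S (F i)] (d : ∀ i, F (i + 1) →ₗ[S] F i)
    (ε : F 0 →ₗ[S] M) {n : ℕ} (hn : ∀ i, n < i → Subsingleton (F i))
    (hε : Function.Surjective ε) (hdε : Function.Exact (d 0) ε)
    (hd : ∀ i, Function.Exact (d (i + 1)) (d i)) : Module.Flat S M := by
  -- Descending induction on the images: zero from index `n` on, then each is the cokernel of an
  -- injection of flat modules.
  have key (j : ℕ) : ∀ i, n ≤ i + j → Module.Flat S (LinearMap.range (d i)) := by
    induction j with
    | zero =>
      intro i hi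
      have := hn (i + 1) (by omega)
      have : Subsingleton (LinearMap.range (d i)) :=
        (d i).surjective_rangeRestrict.subsingleton
      infer_instance
    | succ j ih =>
      intro i hi
      have := ih (i + 1) (by omega)
      refine of_exact_of_isNilpotent_maximalIdeal h
        (LinearMap.range (d (i + 1))).subtype_injective (g := (d i).rangeRestrict) ?_
        (d i).surjective_rangeRestrict
      rw [LinearMap.exact_iff, LinearMap.ker_rangeRestrict, Submodule.range_subtype,
        (LinearMap.exact_iff.mp (hd i))]
  have := key n 0 (by omega)
  refine of_exact_of_isNilpotent_maximalIdeal h (LinearMap.range (d 0)).subtype_injective ?_ hε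
  rw [LinearMap.exact_iff, Submodule.range_subtype, LinearMap.exact_iff.mp hdε]

theorem Module.Flat.subsingleton_of_maximalIdeal_smul_eq_zero [Module.Flat S M]
    (h0 : maximalIdeal S ≠ ⊥)
    (hM : ∀ a ∈ maximalIdeal S, ∀ x : M, a • x = 0) : Subsingleton M := by
  obtain ⟨a, ha, ha0⟩ := Submodule.exists_mem_ne_zero_of_ne_bot h0
  refine subsingleton_of_forall_eq 0 fun x ↦ ?_
  -- The equational criterion writes `x` as a sum of `c j • y j` with `a * c j = 0`; as `a ≠ 0`,
  -- each `c j` is a nonunit and kills `M`.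
  obtain ⟨k, c, y, hx, hc⟩ := isTrivialRelation_of_sum_smul_eq_zero (ι := Unit) (f := fun _ ↦ a)
    (x := fun _ ↦ x) (by simpa using hM a ha x)
  refine (hx ()).trans ?_
  refine Finset.sum_eq_zero fun j _ ↦ hM _ (fun hu ↦ ha0 ?_) _
  exact hu.mul_left_eq_zero.mp (by simpa using hc j)

end NilpotentMaximalIdeal

/-! ### Base change to the localization and conclusion -/

theorem not_hasFlatResolution_residueField {R S : Type u} [CommRing R] [CommRing S] [IsLocalRing S]
    [Algebra R S] [Module.Flat R S]
    (hfrac : ∀ a : S, ∃ r : R, ∃ v : S, IsUnit v ∧ a * v = algebraMap R S r)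
    (h : IsNilpotent (IsLocalRing.maximalIdeal S)) (h0 : IsLocalRing.maximalIdeal S ≠ ⊥) (n : ℕ) :
    ¬ HasFlatResolution R (ModuleCat.of R (IsLocalRing.ResidueField S)) n := by
  rintro ⟨F, d, ε, hF, hn, hε, hdε, hd⟩
  let κ := IsLocalRing.ResidueField S
  let ε' : F 0 →ₗ[R] κ := ε
  have hflat : Module.Flat S (S ⊗[R] κ) := by
    refine Module.Flat.of_finite_resolution_of_isNilpotent_maximalIdeal h
      (F := fun i ↦ S ⊗[R] F i) (fun i ↦ (d i).baseChange S) (ε'.baseChange S) (n := n) ?_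
      (LinearMap.lTensor_surjective S hε) (Module.Flat.lTensor_exact S hdε)
      fun i ↦ Module.Flat.lTensor_exact S (hd i)
    intro i hi
    have := hn i hi
    infer_instance
  have hsub : Subsingleton (S ⊗[R] κ) := by
    refine Module.Flat.subsingleton_of_maximalIdeal_smul_eq_zero h0 fun a ha x ↦ ?_
    -- Only scalars from `R` cross the tensor sign, so `a` is replaced by its unit multiple coming
    -- from `r`, which dies in `κ`.
    obtain ⟨r, v, hv, hr⟩ := hfrac a
    have hr' : algebraMap R κ r = 0 := by
      rw [IsScalarTower.algebraMap_apply R S κ, ← hr]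
      exact (IsLocalRing.residue_eq_zero_iff _).mpr (Ideal.mul_mem_right _ _ ha)
    have hx : r • x = 0 := by
      induction x with
      | zero => simp
      | tmul s y => rw [← tmul_smul, Algebra.smul_def, hr', zero_mul, tmul_zero]
      | add x y hx hy => rw [smul_add, hx, hy, add_zero]
    rw [← hv.smul_eq_zero, smul_smul, mul_comm, hr, algebraMap_smul, hx]
  let φ : S ⊗[R] κ →ₗ[S] κ := (LinearMap.id : κ →ₗ[R] κ).liftBaseChange S
  have hφ : φ (1 ⊗ₜ 1) = 1 := by simp [φ]
  rw [Subsingleton.elim ((1 : S) ⊗ₜ[R] (1 : κ)) 0, map_zero] at hφ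
  exact zero_ne_one hφ

theorem weakGlobalDimension_eq_top_of_forall_not_hasFlatResolution {R : Type u} [CommRing R]
    (M : ModuleCat.{u} R) (h : ∀ n, ¬ HasFlatResolution R M n) : weakGlobalDimension R = ⊤ := by
  exact top_le_iff.mp (le_iSup_of_le M (le_iInf₂ fun n hn ↦ (h n hn).elim))

theorem mainTheorem6 {R : Type u} [CommRing R] (hR : IsGaussianRing R)
    (m : Ideal R) [hm : m.IsMaximal]
    (hne : nilradical (Localization.AtPrime m) ≠ ⊥)
    (hnil : IsNilpotent (nilradical (Localization.AtPrime m)))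
    (hdeg : 3 ≤ nilpotencyClass (nilradical (Localization.AtPrime m))) :
    weakGlobalDimension R = ⊤ := by
  let A := Localization.AtPrime m
  have hA : IsGaussianRing A := hR.of_isLocalization m.primeCompl
  let N := nilradical A
  have hN : N.IsPrime := hA.isPrime_nilradical
  let S := Localization.AtPrime N
  -- If all squares in `N` vanished, all products would too, and the nilpotency degree would be at
  -- most 2.
  obtain ⟨x, hxN, hx⟩ : ∃ x ∈ N, x ^ 2 ≠ 0 := by
    by_contra! hsq
    have hN2 : N ^ 2 = 0 := by
      rw [sq, Ideal.zero_eq_bot, ← le_bot_iff, Ideal.mul_le]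
      intro a ha b hb
      exact hA.mul_eq_zero_of_sq_eq_zero (hsq a ha) (hsq b hb)
    have : nilpotencyClass N ≤ 2 := Nat.sInf_le hN2
    exact absurd (hdeg.trans this) (by norm_num)
  have hmax : N.map (algebraMap A S) = IsLocalRing.maximalIdeal S :=
    Localization.AtPrime.map_eq_maximalIdeal
  have h : IsNilpotent (IsLocalRing.maximalIdeal S) := by
    obtain ⟨k, hk⟩ := hnil
    exact ⟨k, by rw [← hmax, ← Ideal.map_pow, hk, Ideal.zero_eq_bot, Ideal.map_bot,
      Ideal.zero_eq_bot]⟩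
  have h0 : IsLocalRing.maximalIdeal S ≠ ⊥ := by
    intro hbot
    have hx0 : algebraMap A S x = 0 := by
      rw [← Ideal.mem_bot, ← hbot, ← hmax]
      exact Ideal.mem_map_of_mem _ hxN
    -- Now `s * x = 0` with `s ∉ N`, so `s ^ 2 = 0` or `x ^ 2 = 0`; both are impossible.
    obtain ⟨⟨s, hs⟩, hsx⟩ := (IsLocalization.map_eq_zero_iff N.primeCompl S x).mp hx0
    rcases hA.sq_eq_zero_or_sq_eq_zero hsx with h | h
    · exact hs ⟨2, h⟩
    · exact hx h
  have hflatA : Module.Flat R A := IsLocalization.flat A m.primeCompl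
  have hflatS : Module.Flat A S := IsLocalization.flat S N.primeCompl
  have : Module.Flat R S := Module.Flat.trans R A S
  refine weakGlobalDimension_eq_top_of_forall_not_hasFlatResolution _
    (not_hasFlatResolution_residueField (R := R) (S := S) (fun a ↦ ?_) h h0)
  obtain ⟨⟨b, t⟩, hbt⟩ := IsLocalization.surj N.primeCompl a
  obtain ⟨⟨r, u⟩, hru⟩ := IsLocalization.surj m.primeCompl b
  refine ⟨r, algebraMap A S t * algebraMap A S (algebraMap R A u),
    (IsLocalization.map_units S t).mul ((IsLocalization.map_units A u).map (algebraMap A S)), ?_⟩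
  rw [← mul_assoc, hbt, ← map_mul, hru, ← IsScalarTower.algebraMap_apply]
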